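/- Let $\mathbb D\subset\mathbb C$ be the open unit disc, let $\pi_2:\mathbb C^2\to\mathbb C^2$, $\pi_2(\lambda_1,\lambda_2)=(\lambda_1+\lambda_2,\lambda_1\lambda_2)$, and let $\mathbb G_2=\pi_2(\mathbb D^2)$ be the symmetrized bidisc. For an open set $D\subset\mathbb C^n$ let $K_D$ denote its Bergman kernel, i.e. the function on $D\times D$, unique when it exists, such that for every $w\in D$ the function $K_D(\cdot,w)$ is holomorphic and square-integrable on $D$ with respect to Lebesgue measure, and $f(w)=\int_D f(z)\overline{K_D(z,w)}\,dV(z)$ for every $f$ that is holomorphic and square-integrable on $D$. Then the Bergman kernel of $\mathbb G_2$ exists, and for all $\lambda=(\lambda_1,\lambda_2)$ and $\mu=(\mu_1,\mu_2)$ in $\mathbb D^2$, $$K_{\mathbb G_2}(\pi_2(\lambda),\pi_2(\mu))=\frac{2-(\bar\mu_1+\bar\mu_2)(\lambda_1+\lambda_2)+2\lambda_1\lambda_2\bar\mu_1\bar\mu_2}{\pi^2\big((1-\lambda_1\bar\mu_1)(1-\lambda_2\bar\mu_2)(1-\lambda_1\bar\mu_2)(1-\lambda_2\bar\mu_1)\big)^2}.$$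 In particular, $\mathbb G_2$ is a Lu Qi-Keng domain: it is a (nonempty, open, connected) domain, and $K_{\mathbb G_2}(z,w)\neq0$ for all $z,w\in\mathbb G_2$. -/

import Mathlib

open MeasureTheory
open scoped ComplexConjugate

noncomputable section

/-- The open unit polydisc in `ℂⁿ`. -/
def polydisc (n : ℕ) : Set (Fin n → ℂ) :=
  {x | ∀ j, ‖x j‖ < 1}

/-- The symmetrization map `π_n : ℂⁿ → ℂⁿ`; its `k`-th component (`k = 0, …, n - 1`) is the
elementary symmetric polynomial of degree `k + 1`. -/
def symmetrization (n : ℕ) (x : Fin n → ℂ) : Fin n → ℂ :=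
  fun k => ∑ s ∈ Finset.powersetCard ((k : ℕ) + 1) Finset.univ, ∏ j ∈ s, x j

/-- The symmetrized polydisc. -/
def symmetrizedPolydisc (n : ℕ) : Set (Fin n → ℂ) :=
  symmetrization n '' polydisc n

/-- The Bergman space `A²(D)`: functions that are holomorphic and square-integrable on `D` with
respect to Lebesgue measure. Functions are total in Lean; their values outside `D` play no role. -/
def bergmanSpace {n : ℕ} (D : Set (Fin n → ℂ)) : Set ((Fin n → ℂ) → ℂ) :=
  {f | DifferentiableOn ℂ f D ∧ MemLp f 2 (volume.restrict D)}

/-- `K` is a reproducing kernel of `A²(D)`: for each `w ∈ D` the function `K(·, w)` lies in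
`A²(D)`, and `f(w) = ⟨f, K(·, w)⟩` in `L²(D)` for every `f ∈ A²(D)`. For a given open set `D`, these
conditions determine `K` on `D × D`. -/
structure IsBergmanKernel {n : ℕ} (D : Set (Fin n → ℂ))
    (K : (Fin n → ℂ) → (Fin n → ℂ) → ℂ) : Prop where
  mem_bergmanSpace : ∀ w ∈ D, (fun z => K z w) ∈ bergmanSpace D
  reproducing : ∀ f ∈ bergmanSpace D, ∀ w ∈ D, f w = ∫ z in D, f z * conj (K z w)

/-- On an open set, two Bergman kernels agree. -/
theorem IsBergmanKernel.eq_of_isOpen {n : ℕ} {D : Set (Fin n → ℂ)} (hD : IsOpen D)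
    {K L : (Fin n → ℂ) → (Fin n → ℂ) → ℂ} (hK : IsBergmanKernel D K) (hL : IsBergmanKernel D L)
    {z w : Fin n → ℂ} (hz : z ∈ D) (hw : w ∈ D) : K z w = L z w := by
  have hfm : (fun z => K z w - L z w) ∈ bergmanSpace D :=
    ⟨(hK.mem_bergmanSpace w hw).1.sub (hL.mem_bergmanSpace w hw).1,
      (hK.mem_bergmanSpace w hw).2.sub (hL.mem_bergmanSpace w hw).2⟩
  have hint : ∀ M : (Fin n → ℂ) → (Fin n → ℂ) → ℂ, IsBergmanKernel D M →
      Integrable (fun z => (K z w - L z w) * conj (M z w)) (volume.restrict D) := fun M hM =>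
    hfm.2.integrable_mul ((hM.mem_bergmanSpace w hw).2.star)
  have h0 : ∫ z in D, (K z w - L z w) * conj (K z w - L z w) = 0 := by
    simp only [map_sub, mul_sub]
    rw [integral_sub (hint K hK) (hint L hL), ← hK.reproducing _ hfm w hw,
      ← hL.reproducing _ hfm w hw, sub_self]
  have h1 : ∫ z in D, ‖K z w - L z w‖ ^ 2 = 0 := by
    have h : ∀ z, (K z w - L z w) * conj (K z w - L z w) = ((‖K z w - L z w‖ ^ 2 : ℝ) : ℂ) :=
      fun z => by rw [RCLike.mul_conj]; push_cast; rfl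
    simp only [h, integral_complex_ofReal] at h0
    exact_mod_cast h0
  rw [integral_eq_zero_iff_of_nonneg (fun _ => by positivity) (hfm.2.integrable_norm_pow two_ne_zero)] at h1
  have h2 : (fun z => K z w - L z w) =ᵐ[volume.restrict D] fun _ => 0 := by
    filter_upwards [h1] with z hz
    simpa using hz
  exact sub_eq_zero.mp
    (Measure.eqOn_open_of_ae_eq h2 hD hfm.1.continuousOn continuousOn_const hz)

/-- The Bergman kernel `K_D(z, w)` of an open set `D ⊆ ℂⁿ`, for `z, w ∈ D`. -/
def bergmanKernel {n : ℕ} (D : Set (Fin n → ℂ)) : (Fin n → ℂ) → (Fin n → ℂ) → ℂ :=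
  Classical.epsilon (IsBergmanKernel D)

/-- A Lu Qi-Keng domain: a domain (a nonempty connected open set) whose Bergman kernel has no
zeros. -/
structure IsLuQiKengDomain {n : ℕ} (D : Set (Fin n → ℂ)) : Prop where
  isOpen : IsOpen D
  isConnected : IsConnected D
  bergmanKernel_ne_zero : ∀ z ∈ D, ∀ w ∈ D, bergmanKernel D z w ≠ 0

/-- In dimension two, `π₂(x₁, x₂) = (x₁ + x₂, x₁ x₂)`. -/
theorem symmetrization_two (x : Fin 2 → ℂ) :
    symmetrization 2 x = ![x 0 + x 1, x 0 * x 1] := by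
  funext k
  fin_cases k
  · simp [symmetrization, Finset.powersetCard_one]
  · have h : Finset.powersetCard 2 (Finset.univ : Finset (Fin 2)) = {Finset.univ} := by decide
    simp [symmetrization, h]

end

open MeasureTheory
open scoped ComplexConjugate

/-! Everything is transported from the bidisc. The map π₂ has complex Jacobian J(x) = x₀ - x₁ up to
sign and is two-to-one off a null set, so f ↦ J · (f ∘ π₂) sends A² of the symmetrized bidisc to
antisymmetric functions in A² of the bidisc and doubles inner products
(`integral_polydisc_two_comp_symmetrization`). The bidisc has the product of two disc kernels as its
kernel (`integral_polydisc_two_bergman`), and antisymmetric functions are reproduced by its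
antisymmetrization.

That antisymmetrization is a difference of squares A² - B² over a common denominator, and A - B is
exactly the product of the two Jacobian factors. Dividing them out leaves A + B as the numerator
(`sub_mul_sub_mul_conj_symmetrizedBidiscKernel`). The division requires y₀ ≠ y₁; the remaining
points follow by continuity of both sides.

Zeros of the kernel are zeros of A + B, that is, of a sum of two values of the Möbius map u ↦ (1 -
cu)/(1 - du) on the disc. The image of the disc is a disc missing 0, hence convex, so the mean of
two of its points is not 0 (`one_sub_mul_mul_add_ne_zero`). -/

/-! ### The Bergman kernel of the disc. -/

open Set Metric in
/-- Integrating over a circle against the squared Cauchy-type kernel gives the derivative of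
`z ↦ z * f z` at the reflected point. -/
theorem integral_circle_bergman {f : ℂ → ℂ} (hf : DifferentiableOn ℂ f (ball 0 1)) {r : ℝ}
    (hr : 0 < r) (hr1 : r < 1) {w : ℂ} (hw : ‖w‖ < 1) :
    ∫ θ in (-Real.pi)..Real.pi, f (circleMap 0 r θ) *
        ((1 - conj (circleMap 0 r θ) * w) ^ 2)⁻¹ =
      2 * Real.pi * deriv (fun z => z * f z) (r ^ 2 * w) := by
  set g : ℝ → ℂ := fun θ => f (circleMap 0 r θ) * ((1 - conj (circleMap 0 r θ) * w) ^ 2)⁻¹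
    with hg
  have hper : Function.Periodic g (2 * Real.pi) := fun θ => by
    simp only [hg, periodic_circleMap 0 r θ]
  have h1 : ∫ θ in (-Real.pi)..Real.pi, g θ = ∫ θ in (0 : ℝ)..(2 * Real.pi), g θ := by
    have := hper.intervalIntegral_add_eq (-Real.pi) 0
    rw [zero_add, show -Real.pi + 2 * Real.pi = Real.pi by ring] at this
    exact this
  have hw0 : (r ^ 2 * w : ℂ) ∈ ball (0 : ℂ) r := by
    rw [mem_ball_zero_iff, norm_mul, norm_pow, Complex.norm_real, Real.norm_of_nonneg hr.le]
    nlinarith [norm_nonneg w]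
  have hF : DifferentiableOn ℂ (fun z => z * f z) (ball 0 1) := differentiableOn_id.mul hf
  have h2 := Complex.two_pi_I_inv_smul_circleIntegral_sub_sq_inv_smul_of_differentiable
    isOpen_ball (closedBall_subset_ball hr1) hF hw0
  rw [h1, ← h2, smul_eq_mul, ← mul_assoc]
  rw [circleIntegral, ← intervalIntegral.integral_const_mul]
  refine intervalIntegral.integral_congr fun θ _ => ?_
  simp only [hg, deriv_circleMap, smul_eq_mul]
  set z := circleMap 0 r θ with hz
  have hzn : ‖z‖ = r := by rw [hz, norm_circleMap_zero, abs_of_pos hr]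
  have hz0 : z ≠ 0 := by rw [← norm_pos_iff, hzn]; exact hr
  -- On this circle the kernel becomes z² / (z - r²w)², the Cauchy kernel for a derivative at r²w.
  -- One factor z is absorbed into z f(z), the other cancels against dz = iz dθ.
  have hzz : conj z = r ^ 2 / z := by
    rw [eq_div_iff hz0, mul_comm, RCLike.mul_conj, hzn]; rfl
  have hne : z - r ^ 2 * w ≠ 0 := by
    intro h
    have : ‖z‖ < r := by rw [sub_eq_zero.mp h]; exact mem_ball_zero_iff.mp hw0
    exact this.ne hzn
  have hne' : 1 - r ^ 2 / z * w ≠ 0 := by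
    have : 1 - r ^ 2 / z * w = (z - r ^ 2 * w) / z := by field_simp
    rw [this]; exact div_ne_zero hne hz0
  have hpi : (Real.pi : ℂ) ≠ 0 := by exact_mod_cast Real.pi_ne_zero
  have hI := Complex.I_ne_zero
  have : 1 - r ^ 2 / z * w = (z - r ^ 2 * w) / z := by field_simp
  rw [hzz, this]
  field_simp

/-- The Bergman kernel of the disc is bounded in its first variable. -/
theorem norm_inv_one_sub_conj_mul_sq_le {z w : ℂ} (hz : ‖z‖ ≤ 1) (hw : ‖w‖ < 1) :
    ‖((1 - conj z * w) ^ 2)⁻¹‖ ≤ ((1 - ‖w‖) ^ 2)⁻¹ := by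
  rw [norm_inv, norm_pow]
  have h1 : 1 - ‖w‖ ≤ ‖1 - conj z * w‖ := by
    have := norm_sub_norm_le (1 : ℂ) (conj z * w)
    rw [norm_one, norm_mul, RCLike.norm_conj] at this
    nlinarith [norm_nonneg w]
  have h0 : 0 < 1 - ‖w‖ := by linarith
  gcongr

theorem one_sub_conj_mul_ne_zero {z w : ℂ} (hz : ‖z‖ ≤ 1) (hw : ‖w‖ < 1) :
    1 - conj z * w ≠ 0 := by
  intro h
  have h1 : ‖conj z * w‖ = 1 := by rw [← sub_eq_zero.mp h, norm_one]
  rw [norm_mul, RCLike.norm_conj] at h1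
  nlinarith [norm_nonneg w, norm_nonneg z]

open Set Metric in
theorem continuousOn_inv_one_sub_conj_mul_sq {w : ℂ} (hw : ‖w‖ < 1) :
    ContinuousOn (fun z : ℂ => ((1 - conj z * w) ^ 2)⁻¹) (closedBall 0 1) := by
  refine ContinuousOn.inv₀ (Continuous.continuousOn (by fun_prop)) fun z hz => ?_
  exact pow_ne_zero 2 (one_sub_conj_mul_ne_zero (mem_closedBall_zero_iff.mp hz) hw)

open Set Metric in
/-- Integration in polar coordinates over a disc. -/
theorem integral_ball_eq_polar {g : ℂ → ℂ} {R : ℝ} (hR : 0 < R)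
    (hg : ContinuousOn g (closedBall 0 R)) :
    ∫ z in ball (0 : ℂ) R, g z =
      ∫ r in (0 : ℝ)..R, (r : ℂ) * ∫ θ in (-Real.pi)..Real.pi, g (circleMap 0 r θ) := by
  have hpol : ∀ p : ℝ × ℝ, Complex.polarCoord.symm p = circleMap 0 p.1 p.2 := fun p => by
    rw [Complex.polarCoord_symm_apply, circleMap, zero_add, Complex.exp_mul_I]
    push_cast; ring
  rw [← integral_indicator measurableSet_ball, ← Complex.integral_comp_polarCoord_symm]
  have hset : (Ioo 0 R ×ˢ Ioo (-Real.pi) Real.pi : Set (ℝ × ℝ)) ⊆ polarCoord.target := by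
    rw [polarCoord_target]
    exact prod_mono Ioo_subset_Ioi_self subset_rfl
  have hmeas : MeasurableSet (Ioo 0 R ×ˢ Ioo (-Real.pi) Real.pi : Set (ℝ × ℝ)) :=
    measurableSet_Ioo.prod measurableSet_Ioo
  have h1 : ∫ p in polarCoord.target,
        p.1 • (ball (0 : ℂ) R).indicator g (Complex.polarCoord.symm p) =
      ∫ p in (Ioo 0 R ×ˢ Ioo (-Real.pi) Real.pi : Set (ℝ × ℝ)),
        (p.1 : ℂ) * g (circleMap 0 p.1 p.2) := by
    refine (setIntegral_eq_of_subset_of_forall_sdiff_eq_zero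
      polarCoord.open_target.measurableSet hset fun p hp => ?_).trans
        (setIntegral_congr_fun hmeas fun p hp => ?_)
    · rw [hpol, indicator_of_notMem, smul_zero]
      rw [mem_ball_zero_iff, norm_circleMap_zero]
      intro h
      rw [polarCoord_target] at hp
      exact hp.2 ⟨⟨hp.1.1, (le_abs_self _).trans_lt h⟩, hp.1.2⟩
    · rw [hpol, indicator_of_mem, Complex.real_smul]
      rw [mem_ball_zero_iff, norm_circleMap_zero, abs_of_pos hp.1.1]
      exact hp.1.2
  rw [h1, Measure.volume_eq_prod, setIntegral_prod]
  · rw [intervalIntegral.integral_of_le hR.le, integral_Ioc_eq_integral_Ioo]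
    refine setIntegral_congr_fun measurableSet_Ioo fun r _ => ?_
    simp only
    rw [intervalIntegral.integral_of_le (by linarith [Real.pi_pos]),
      integral_Ioc_eq_integral_Ioo, integral_const_mul]
  · have hc : ContinuousOn (fun p : ℝ × ℝ => (p.1 : ℂ) * g (circleMap 0 p.1 p.2))
        (Icc 0 R ×ˢ Icc (-Real.pi) Real.pi) := by
      refine ContinuousOn.mul (Continuous.continuousOn (by fun_prop)) ?_
      refine hg.comp (Continuous.continuousOn (by unfold circleMap; fun_prop)) fun p hp => ?_
      rw [mem_closedBall_zero_iff, norm_circleMap_zero, abs_of_nonneg hp.1.1]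
      exact hp.1.2
    exact (hc.integrableOn_compact (isCompact_Icc.prod isCompact_Icc)).mono_set
      (prod_mono Ioo_subset_Icc_self Ioo_subset_Icc_self)

-- The circle integrals turn the radial integrand into 2πr (zf)'(r²w), an exact derivative in r.
-- Staying at radius R < 1 keeps the integrand continuous up to the boundary.
open Set Metric in
theorem integral_ball_bergman {f : ℂ → ℂ} (hf : DifferentiableOn ℂ f (ball 0 1)) {R : ℝ}
    (hR : 0 < R) (hR1 : R < 1) {w : ℂ} (hw : ‖w‖ < 1) :
    ∫ z in ball (0 : ℂ) R, f z * ((1 - conj z * w) ^ 2)⁻¹ =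
      Real.pi * (R ^ 2 * f (R ^ 2 * w)) := by
  have hF : DifferentiableOn ℂ (fun z => z * f z) (ball 0 1) := differentiableOn_id.mul hf
  rw [integral_ball_eq_polar hR]
  · have hmem : ∀ r ∈ Icc 0 R, (r ^ 2 * w : ℂ) ∈ ball (0 : ℂ) 1 := fun r hr => by
      rw [mem_ball_zero_iff, norm_mul, norm_pow, Complex.norm_real, Real.norm_of_nonneg hr.1]
      have : r ^ 2 ≤ 1 := by nlinarith [hr.1, hr.2]
      nlinarith [norm_nonneg w]
    have hd : DifferentiableOn ℂ (deriv (fun z => z * f z)) (ball 0 1) := hF.deriv isOpen_ball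
    have hdc : ContinuousOn (fun r : ℝ => 2 * Real.pi * (r : ℂ) *
        deriv (fun z => z * f z) (r ^ 2 * w)) (Icc 0 R) :=
      ContinuousOn.mul (Continuous.continuousOn (by fun_prop))
        (hd.continuousOn.comp (Continuous.continuousOn (by fun_prop)) hmem)
    have h1 : ∫ r in (0 : ℝ)..R, (r : ℂ) * ∫ θ in (-Real.pi)..Real.pi,
          f (circleMap 0 r θ) * ((1 - conj (circleMap 0 r θ) * w) ^ 2)⁻¹ =
        ∫ r in (0 : ℝ)..R, 2 * Real.pi * (r : ℂ) * deriv (fun z => z * f z) (r ^ 2 * w) := by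
      refine intervalIntegral.integral_congr fun r hr => ?_
      rw [uIcc_of_le hR.le] at hr
      rcases hr.1.eq_or_lt with h0 | h0
      · simp [← h0]
      · rw [integral_circle_bergman hf h0 (hr.2.trans_lt hR1) hw]; ring
    rw [h1]
    -- The antiderivative used below divides by w, the chain-rule factor of r ↦ r²w being 2rw; at w
    -- = 0 the radial integrand is simply 2πr f(0).
    by_cases hw0 : w = 0
    · subst hw0
      have hdf : deriv (fun z => z * f z) 0 = f 0 := by
        have := ((hasDerivAt_id (0 : ℂ)).mul
          (hf.differentiableAt (isOpen_ball.mem_nhds (mem_ball_self one_pos))).hasDerivAt).deriv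
        simpa [Pi.mul_def] using this
      simp only [mul_zero, hdf]
      rw [intervalIntegral.integral_mul_const, intervalIntegral.integral_const_mul,
        intervalIntegral.integral_ofReal, integral_id]
      push_cast; ring
    have h2 := intervalIntegral.integral_eq_sub_of_hasDerivAt (a := 0) (b := R)
      (f := fun r : ℝ => Real.pi / w * ((r ^ 2 * w) * f (r ^ 2 * w)))
      (f' := fun r : ℝ => 2 * Real.pi * (r : ℂ) * deriv (fun z => z * f z) (r ^ 2 * w)) ?_ ?_
    · rw [h2]
      simp only [Complex.ofReal_zero, ne_eq, OfNat.ofNat_ne_zero, not_false_eq_true, zero_pow,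
        zero_mul, mul_zero, sub_zero]
      rw [div_mul_eq_mul_div, div_eq_iff hw0]
      ring
    · intro r hr
      rw [uIcc_of_le hR.le] at hr
      have hz : HasDerivAt (fun z => z * f z) (deriv (fun z => z * f z) (r ^ 2 * w))
        ((r : ℂ) ^ 2 * w) :=
        (hF.differentiableAt (isOpen_ball.mem_nhds (hmem r hr))).hasDerivAt
      have hi : HasDerivAt (fun z : ℂ => z ^ 2 * w) (2 * r * w) (r : ℂ) := by
        simpa using ((hasDerivAt_id (r : ℂ)).pow 2).mul_const w
      have := ((HasDerivAt.comp (r : ℂ) hz hi).comp_ofReal).const_mul (Real.pi / w : ℂ)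
      have he : 2 * Real.pi * (r : ℂ) * deriv (fun z => z * f z) (r ^ 2 * w) =
          Real.pi / w * (deriv (fun z => z * f z) (r ^ 2 * w) * (2 * r * w)) := by
        rw [div_mul_eq_mul_div, eq_div_iff hw0]
        ring
      rw [he]
      exact this
    · exact (hdc.mono (by rw [uIcc_of_le hR.le])).intervalIntegrable
  · exact (hf.continuousOn.mono (closedBall_subset_ball hR1)).mul
      ((continuousOn_inv_one_sub_conj_mul_sq hw).mono (closedBall_subset_closedBall hR1.le))

open Set Metric Filter Topology in
/-- The reproducing property of the Bergman kernel of the disc, for integrable holomorphic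
functions. -/
theorem integral_unitBall_bergman {f : ℂ → ℂ} (hf : DifferentiableOn ℂ f (ball 0 1))
    (hfi : IntegrableOn f (ball 0 1)) {w : ℂ} (hw : ‖w‖ < 1) :
    ∫ z in ball (0 : ℂ) 1, f z * ((1 - conj z * w) ^ 2)⁻¹ = Real.pi * f w := by
  have hint : IntegrableOn (fun z => f z * ((1 - conj z * w) ^ 2)⁻¹) (ball 0 1) := by
    refine Integrable.mul_bdd hfi (c := ((1 - ‖w‖) ^ 2)⁻¹) ?_ ?_
    · exact ((continuousOn_inv_one_sub_conj_mul_sq hw).mono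
        ball_subset_closedBall).aestronglyMeasurable measurableSet_ball
    · exact (ae_restrict_mem measurableSet_ball).mono fun z hz =>
        norm_inv_one_sub_conj_mul_sq_le (mem_ball_zero_iff.mp hz).le hw
  -- Radii increasing to 1; the shift by 2 makes the first one positive.
  let R : ℕ → ℝ := fun n => 1 - 1 / ((n : ℝ) + 2)
  have hR0 : ∀ n, 0 < R n := fun n => by
    have : (1 : ℝ) / ((n : ℝ) + 2) < 1 := by
      rw [div_lt_one (by positivity)]
      linarith [n.cast_nonneg (α := ℝ)]
    simp only [R]; linarith
  have hR1 : ∀ n, R n < 1 := fun n => by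
    have : 0 < (1 : ℝ) / ((n : ℝ) + 2) := by positivity
    simp only [R]; linarith
  have hRt : Tendsto R atTop (𝓝 1) := by
    have h : Tendsto (fun n : ℕ => (1 : ℝ) / ((n : ℝ) + 2)) atTop (𝓝 0) :=
      tendsto_const_nhds.div_atTop (tendsto_atTop_add_const_right _ _ tendsto_natCast_atTop_atTop)
    simpa [R] using h.const_sub 1
  have hRm : Monotone R := fun m n hmn => by
    have : (m : ℝ) ≤ n := by exact_mod_cast hmn
    simp only [R]; gcongr
  have hU : ⋃ n, ball (0 : ℂ) (R n) = ball 0 1 := by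
    ext z
    simp only [mem_iUnion, mem_ball_zero_iff]
    exact ⟨fun ⟨n, h⟩ => h.trans (hR1 n), fun h => (hRt.eventually (lt_mem_nhds h)).exists⟩
  have h1 := tendsto_setIntegral_of_monotone (μ := volume) (fun n => measurableSet_ball)
    (fun m n hmn => ball_subset_ball (hRm hmn)) (hU.symm ▸ hint)
  rw [hU] at h1
  refine tendsto_nhds_unique h1 ?_
  simp only [fun n => integral_ball_bergman hf (hR0 n) (hR1 n) hw]
  have hRc : Tendsto (fun n => ((R n : ℝ) : ℂ) ^ 2) atTop (𝓝 1) := by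
    simpa using ((Complex.continuous_ofReal.tendsto 1).comp hRt).pow 2
  have hcf : Tendsto f (𝓝 w) (𝓝 (f w)) :=
    (hf.differentiableAt (isOpen_ball.mem_nhds (mem_ball_zero_iff.mpr hw))).continuousAt
  have h2 : Tendsto (fun n => f (((R n : ℝ) : ℂ) ^ 2 * w)) atTop (𝓝 (f w)) :=
    hcf.comp (by simpa using hRc.mul_const w)
  simpa using (hRc.mul h2).const_mul (Real.pi : ℂ)

/-! ### The Bergman kernel of the bidisc. -/

open Set Metric in
/-- The reproducing property of the Bergman kernel of the bidisc. -/
theorem integral_ball_prod_ball_bergman {F : ℂ × ℂ → ℂ}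
    (hF : DifferentiableOn ℂ F (ball 0 1 ×ˢ ball 0 1))
    (hFi : IntegrableOn F (ball 0 1 ×ˢ ball 0 1)) {v w : ℂ} (hv : ‖v‖ < 1) (hw : ‖w‖ < 1) :
    ∫ p in ball (0 : ℂ) 1 ×ˢ ball (0 : ℂ) 1,
      F p * (((1 - conj p.1 * v) ^ 2)⁻¹ * ((1 - conj p.2 * w) ^ 2)⁻¹) =
      Real.pi ^ 2 * F (v, w) := by
  have hms : MeasurableSet (ball (0 : ℂ) 1 ×ˢ ball (0 : ℂ) 1) :=
    measurableSet_ball.prod measurableSet_ball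
  have hk1 : ContinuousOn (fun p : ℂ × ℂ => ((1 - conj p.1 * v) ^ 2)⁻¹)
      (ball 0 1 ×ˢ ball 0 1) :=
    (continuousOn_inv_one_sub_conj_mul_sq hv).comp continuousOn_fst
      fun p hp => ball_subset_closedBall hp.1
  have hk2 : ContinuousOn (fun p : ℂ × ℂ => ((1 - conj p.2 * w) ^ 2)⁻¹)
      (ball 0 1 ×ˢ ball 0 1) :=
    (continuousOn_inv_one_sub_conj_mul_sq hw).comp continuousOn_snd
      fun p hp => ball_subset_closedBall hp.2
  have hi2 : IntegrableOn (fun p : ℂ × ℂ => F p * ((1 - conj p.2 * w) ^ 2)⁻¹)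
      (ball 0 1 ×ˢ ball 0 1) :=
    Integrable.mul_bdd hFi (c := ((1 - ‖w‖) ^ 2)⁻¹) (hk2.aestronglyMeasurable hms)
      ((ae_restrict_mem hms).mono fun p hp =>
        norm_inv_one_sub_conj_mul_sq_le (mem_ball_zero_iff.mp hp.2).le hw)
  have hi12 : IntegrableOn (fun p : ℂ × ℂ =>
      F p * ((1 - conj p.2 * w) ^ 2)⁻¹ * ((1 - conj p.1 * v) ^ 2)⁻¹)
      (ball 0 1 ×ˢ ball 0 1) :=
    Integrable.mul_bdd hi2 (c := ((1 - ‖v‖) ^ 2)⁻¹) (hk1.aestronglyMeasurable hms)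
      ((ae_restrict_mem hms).mono fun p hp =>
        norm_inv_one_sub_conj_mul_sq_le (mem_ball_zero_iff.mp hp.1).le hv)
  have hd1 : ∀ z ∈ ball (0 : ℂ) 1, DifferentiableOn ℂ (fun u => F (z, u)) (ball 0 1) :=
    fun z hz => hF.comp (by fun_prop) fun u hu => ⟨hz, hu⟩
  have hd2 : DifferentiableOn ℂ (fun z => F (z, w)) (ball 0 1) :=
    hF.comp (by fun_prop) fun z hz => ⟨hz, mem_ball_zero_iff.mpr hw⟩
  rw [Measure.volume_eq_prod] at hi12 hi2 hFi
  have hpt : ∀ᵐ z ∂(volume.restrict (ball (0 : ℂ) 1)),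
      ∫ u in ball (0 : ℂ) 1, F (z, u) * ((1 - conj u * w) ^ 2)⁻¹ = Real.pi * F (z, w) := by
    rw [IntegrableOn, ← Measure.prod_restrict] at hFi
    filter_upwards [hFi.prod_right_ae, ae_restrict_mem measurableSet_ball] with z hz hzb
    exact integral_unitBall_bergman (hd1 z hzb) hz hw
  have hpi : (Real.pi : ℂ) ≠ 0 := by exact_mod_cast Real.pi_ne_zero
  -- Fubini alone gives integrable slices only for almost every w. Here every w works: by `hpt` the
  -- slice is, up to the factor π, the inner integral of an integrable function.
  have hi : IntegrableOn (fun z => F (z, w)) (ball 0 1) := by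
    rw [IntegrableOn, ← Measure.prod_restrict] at hi2
    have := hi2.integral_prod_left.congr hpt
    simpa [IntegrableOn, ← mul_assoc, hpi] using this.const_mul (Real.pi : ℂ)⁻¹
  calc _ = ∫ p in ball (0 : ℂ) 1 ×ˢ ball (0 : ℂ) 1,
        F p * ((1 - conj p.2 * w) ^ 2)⁻¹ * ((1 - conj p.1 * v) ^ 2)⁻¹ := by
        refine integral_congr_ae (ae_of_all _ fun p => ?_)
        simp only
        ring
    _ = ∫ z in ball (0 : ℂ) 1, (Real.pi * F (z, w)) * ((1 - conj z * v) ^ 2)⁻¹ := by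
        rw [Measure.volume_eq_prod, setIntegral_prod _ hi12]
        refine integral_congr_ae ?_
        filter_upwards [hpt] with z hz
        rw [integral_mul_const, hz]
    _ = Real.pi ^ 2 * F (v, w) := by
        simp only [mul_assoc]
        rw [integral_const_mul, integral_unitBall_bergman hd2 hi hv]
        ring

open Set Metric in
/-- The reproducing property of the Bergman kernel of the bidisc. -/
theorem integral_polydisc_two_bergman {F : (Fin 2 → ℂ) → ℂ}
    (hF : DifferentiableOn ℂ F (polydisc 2)) (hFi : IntegrableOn F (polydisc 2))
    {y : Fin 2 → ℂ} (hy : y ∈ polydisc 2) :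
    ∫ x in polydisc 2,
      F x * (((1 - conj (x 0) * y 0) ^ 2)⁻¹ * ((1 - conj (x 1) * y 1) ^ 2)⁻¹) =
      Real.pi ^ 2 * F y := by
  let e := (MeasurableEquiv.finTwoArrow (α := ℂ)).symm
  have he : MeasurePreserving e volume volume := (volume_preserving_finTwoArrow ℂ).symm
  have hpre : e ⁻¹' polydisc 2 = ball 0 1 ×ˢ ball 0 1 := by
    ext p
    simp [e, polydisc, Fin.forall_fin_two, MeasurableEquiv.finTwoArrow]
  have hev : ∀ p, e p = ![p.1, p.2] := fun p => rfl
  have hed : Differentiable ℂ e := by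
    rw [differentiable_pi]
    intro i
    fin_cases i
    · exact differentiable_fst
    · exact differentiable_snd
  have h := integral_ball_prod_ball_bergman (F := F ∘ e)
    (hF.comp hed.differentiableOn (by rw [← hpre]; exact mapsTo_preimage _ _))
    (by rw [← hpre, he.integrableOn_comp_preimage e.measurableEmbedding]; exact hFi)
    (hy 0) (hy 1)
  rw [← he.setIntegral_preimage_emb e.measurableEmbedding, hpre]
  have hye : e (y 0, y 1) = y := by
    ext i; fin_cases i <;> rfl
  simp only [Function.comp_apply, hye] at h
  exact h

/-! ### The symmetrized bidisc as a bounded domain. -/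

theorem symmetrization_two_zero (x : Fin 2 → ℂ) : symmetrization 2 x 0 = x 0 + x 1 := by
  rw [symmetrization_two]; rfl

theorem symmetrization_two_one (x : Fin 2 → ℂ) : symmetrization 2 x 1 = x 0 * x 1 := by
  rw [symmetrization_two]; rfl

theorem mem_polydisc_two {x : Fin 2 → ℂ} : x ∈ polydisc 2 ↔ ‖x 0‖ < 1 ∧ ‖x 1‖ < 1 := by
  simp [polydisc, Fin.forall_fin_two]

/-- A Schur–Cohn type inequality, for the roots of a monic quadratic polynomial. -/
theorem norm_add_sub_conj_mul_add_lt_one_iff {a b : ℂ} :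
    ‖(a + b) - conj (a + b) * (a * b)‖ + ‖a * b‖ ^ 2 < 1 ↔ ‖a‖ < 1 ∧ ‖b‖ < 1 := by
  have key : (a + b) - conj (a + b) * (a * b) =
      a * (1 - (‖b‖ : ℂ) ^ 2) + b * (1 - (‖a‖ : ℂ) ^ 2) := by
    have h : ∀ c : ℂ, (‖c‖ : ℂ) ^ 2 = c * conj c := fun c => (RCLike.mul_conj c).symm
    rw [h, h, map_add]; ring
  have hr : ∀ c d : ℂ, ‖c * (1 - (‖d‖ : ℂ) ^ 2)‖ = ‖c‖ * |1 - ‖d‖ ^ 2| := fun c d => by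
    rw [norm_mul, ← Real.norm_eq_abs, ← Complex.norm_real]; push_cast; rfl
  -- With s = ‖c‖ and t = ‖d‖, the reverse triangle inequality bounds the norm below by s(1 - t²) -
  -- t(s² - 1) = (s + t)(1 - st). The claim reduces to (s - 1)(1 - t)(1 - st) ≥ 0. The converse
  -- direction uses the same factorization with the triangle inequality.
  have large : ∀ c d : ℂ, 1 ≤ ‖c‖ → ‖c‖ * ‖d‖ < 1 →
      1 ≤ ‖c * (1 - (‖d‖ : ℂ) ^ 2) + d * (1 - (‖c‖ : ℂ) ^ 2)‖ + (‖c‖ * ‖d‖) ^ 2 := by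
    intro c d hc hcd
    have hd : ‖d‖ < 1 := by nlinarith [norm_nonneg d]
    have h := norm_sub_le_norm_add (c * (1 - (‖d‖ : ℂ) ^ 2)) (d * (1 - (‖c‖ : ℂ) ^ 2))
    rw [hr, hr, abs_of_nonneg (by nlinarith [norm_nonneg d]),
      abs_of_nonpos (by nlinarith [norm_nonneg c])] at h
    nlinarith [mul_nonneg (mul_nonneg (sub_nonneg.mpr hc) (sub_nonneg.mpr hd.le))
      (sub_nonneg.mpr hcd.le)]
  rw [key, norm_mul a b]
  constructor
  · intro h
    have hab : ‖a‖ * ‖b‖ < 1 := by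
      nlinarith [norm_nonneg (a * (1 - (‖b‖ : ℂ) ^ 2) + b * (1 - (‖a‖ : ℂ) ^ 2))]
    constructor
    · by_contra! hc
      exact absurd (large a b hc hab) (not_le.mpr h)
    · by_contra! hc
      have := large b a hc (by rwa [mul_comm])
      rw [add_comm (b * _), mul_comm ‖b‖] at this
      exact absurd this (not_le.mpr h)
  · rintro ⟨ha, hb⟩
    have h := norm_add_le (a * (1 - (‖b‖ : ℂ) ^ 2)) (b * (1 - (‖a‖ : ℂ) ^ 2))
    rw [hr, hr, abs_of_nonneg (by nlinarith [norm_nonneg b]),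
      abs_of_nonneg (by nlinarith [norm_nonneg a])] at h
    have hab : ‖a‖ * ‖b‖ < 1 := by nlinarith [norm_nonneg a, norm_nonneg b]
    nlinarith [mul_pos (mul_pos (sub_pos.mpr ha) (sub_pos.mpr hb)) (sub_pos.mpr hab)]

/-- Every point of `ℂ²` lies in the image of the symmetrization map. -/
theorem symmetrization_two_surjective : Function.Surjective (symmetrization 2) := by
  intro z
  obtain ⟨d, hd⟩ := IsAlgClosed.exists_pow_nat_eq (z 0 ^ 2 - 4 * z 1) two_pos
  refine ⟨![(z 0 + d) / 2, (z 0 - d) / 2], ?_⟩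
  funext i
  fin_cases i
  · simp only [Fin.zero_eta, symmetrization_two_zero]
    simp; ring
  · simp only [Fin.mk_one, symmetrization_two_one]
    simp; linear_combination -hd / 4

/-- Describes the image by a strict inequality between continuous functions, so that openness is
immediate. -/
theorem mem_symmetrizedPolydisc_two_iff {z : Fin 2 → ℂ} :
    z ∈ symmetrizedPolydisc 2 ↔ ‖z 0 - conj (z 0) * z 1‖ + ‖z 1‖ ^ 2 < 1 := by
  have h : ∀ x : Fin 2 → ℂ, x ∈ polydisc 2 ↔
      ‖symmetrization 2 x 0 - conj (symmetrization 2 x 0) * symmetrization 2 x 1‖ +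
        ‖symmetrization 2 x 1‖ ^ 2 < 1 := fun x => by
    rw [symmetrization_two_zero, symmetrization_two_one, norm_add_sub_conj_mul_add_lt_one_iff,
      mem_polydisc_two]
  constructor
  · rintro ⟨x, hx, rfl⟩
    exact (h x).mp hx
  · intro hz
    obtain ⟨x, rfl⟩ := symmetrization_two_surjective z
    exact ⟨x, (h x).mpr hz, rfl⟩

theorem isOpen_symmetrizedPolydisc_two : IsOpen (symmetrizedPolydisc 2) := by
  have : symmetrizedPolydisc 2 =
      {z : Fin 2 → ℂ | ‖z 0 - conj (z 0) * z 1‖ + ‖z 1‖ ^ 2 < 1} :=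
    Set.ext fun z => mem_symmetrizedPolydisc_two_iff
  rw [this]
  exact isOpen_lt (by fun_prop) continuous_const

theorem polydisc_eq_ball (n : ℕ) : polydisc n = Metric.ball 0 1 := by
  ext x
  rw [mem_ball_zero_iff, pi_norm_lt_iff one_pos]
  rfl

theorem differentiable_symmetrization_two : Differentiable ℂ (symmetrization 2) := by
  rw [differentiable_pi]
  intro i
  fin_cases i
  · simp only [Fin.zero_eta, symmetrization_two_zero]; fun_prop
  · simp only [Fin.mk_one, symmetrization_two_one]; fun_prop

theorem isConnected_symmetrizedPolydisc_two : IsConnected (symmetrizedPolydisc 2) := by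
  refine IsConnected.image ?_ _ differentiable_symmetrization_two.continuous.continuousOn
  rw [polydisc_eq_ball]
  exact ⟨⟨0, Metric.mem_ball_self one_pos⟩, (convex_ball 0 1).isPreconnected⟩

theorem isBounded_symmetrizedPolydisc_two : Bornology.IsBounded (symmetrizedPolydisc 2) := by
  refine (Metric.isBounded_closedBall (x := (0 : Fin 2 → ℂ)) (r := 2)).subset ?_
  rintro _ ⟨x, hx, rfl⟩
  obtain ⟨h0, h1⟩ := mem_polydisc_two.mp hx
  rw [mem_closedBall_zero_iff, pi_norm_le_iff_of_nonneg zero_le_two, Fin.forall_fin_two,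
    symmetrization_two_zero, symmetrization_two_one, norm_mul]
  exact ⟨(norm_add_le _ _).trans (by linarith),
    by nlinarith [norm_nonneg (x 0), norm_nonneg (x 1)]⟩

/-! ### The explicit kernel: zeros and bounds. -/

/-- The numbers `(1 - c w) / (1 - d w)`, for `c`, `d`, `w` in the unit disc, do not add up to zero
for two values of `w`. -/
theorem one_sub_mul_mul_add_ne_zero {c d v w : ℂ} (hc : ‖c‖ < 1) (hd : ‖d‖ < 1) (hv : ‖v‖ < 1)
    (hw : ‖w‖ < 1) :
    (1 - c * v) * (1 - d * w) + (1 - c * w) * (1 - d * v) ≠ 0 := by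
  intro h
  have hne : ∀ u : ℂ, ‖u‖ < 1 → 1 - d * u ≠ 0 := fun u hu h0 => by
    have h1 : ‖d * u‖ = 1 := by rw [← sub_eq_zero.mp h0, norm_one]
    rw [norm_mul] at h1
    nlinarith [norm_nonneg d, norm_nonneg u]
  have hsq : ∀ a b : ℂ, ‖a - b‖ ^ 2 + (1 - ‖a‖ ^ 2) * (1 - ‖b‖ ^ 2) = ‖1 - a * conj b‖ ^ 2 := by
    intro a b
    simp only [Complex.sq_norm, Complex.normSq_apply, Complex.sub_re, Complex.sub_im,
      Complex.mul_re, Complex.mul_im, Complex.conj_re, Complex.conj_im, Complex.one_re,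
      Complex.one_im]
    ring
  have hlt : ∀ a b : ℂ, ‖a‖ < 1 → ‖b‖ < 1 → ‖a - b‖ < ‖1 - a * conj b‖ := fun a b ha hb => by
    refine lt_of_pow_lt_pow_left₀ 2 (norm_nonneg _) ?_
    rw [← hsq a b]
    have : 0 < (1 - ‖a‖ ^ 2) * (1 - ‖b‖ ^ 2) :=
      mul_pos (by nlinarith [norm_nonneg a]) (by nlinarith [norm_nonneg b])
    linarith
  have hm : ∀ u : ℂ, ‖u‖ < 1 → ‖(u - conj d) / (1 - d * u)‖ < 1 := fun u hu => by
    rw [norm_div, div_lt_one (norm_pos_iff.mpr (hne u hu))]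
    simpa [mul_comm] using hlt u (conj d) hu (by simpa using hd)
  -- With φ(u) = (u - d̄)/(1 - du), a disc automorphism up to rotation, one has (1 - |d|²)(1 -
  -- cu)/(1 - du) = (1 - cd̄) - (c - d)φ(u). Adding this for u = v, w and using `h` gives the
  -- identity, which contradicts |φ| < 1 and |c - d| < |1 - cd̄|.
  have key : 2 * (1 - c * conj d) =
      (c - d) * ((v - conj d) / (1 - d * v) + (w - conj d) / (1 - d * w)) := by
    have hv' := hne v hv
    have hw' := hne w hw
    field_simp
    linear_combination (1 - d * conj d) * h
  have h1 := congrArg norm key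
  rw [norm_mul, norm_mul, Complex.norm_two] at h1
  have h2 := norm_add_le ((v - conj d) / (1 - d * v)) ((w - conj d) / (1 - d * w))
  nlinarith [hm v hv, hm w hw, hlt c d hc hd, norm_nonneg (c - d)]

/-- The product of the factors `1 - x i * conj (y j)`, in terms of `symmetrization 2 x` and
`symmetrization 2 y`. -/
noncomputable def symmetrizedBidiscDenom (z w : Fin 2 → ℂ) : ℂ :=
  1 - z 0 * conj (w 0) + z 1 * (conj (w 0) ^ 2 - 2 * conj (w 1)) + z 0 ^ 2 * conj (w 1) -
    z 0 * z 1 * conj (w 0) * conj (w 1) + z 1 ^ 2 * conj (w 1) ^ 2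

theorem symmetrizedBidiscDenom_symmetrization (x y : Fin 2 → ℂ) :
    symmetrizedBidiscDenom (symmetrization 2 x) (symmetrization 2 y) =
      (1 - x 0 * conj (y 0)) * (1 - x 1 * conj (y 1)) *
        (1 - x 0 * conj (y 1)) * (1 - x 1 * conj (y 0)) := by
  simp only [symmetrizedBidiscDenom, symmetrization_two_zero, symmetrization_two_one, map_add,
    map_mul]
  ring

/-- The explicit formula for the Bergman kernel of the symmetrized bidisc. -/
noncomputable def symmetrizedBidiscKernel (z w : Fin 2 → ℂ) : ℂ :=
  (2 - conj (w 0) * z 0 + 2 * (z 1 * conj (w 1))) /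
    ((Real.pi : ℂ) ^ 2 * symmetrizedBidiscDenom z w ^ 2)

theorem symmetrizedBidiscKernel_symmetrization (x y : Fin 2 → ℂ) :
    symmetrizedBidiscKernel (symmetrization 2 x) (symmetrization 2 y) =
      (2 - (conj (y 0) + conj (y 1)) * (x 0 + x 1)
          + 2 * (x 0 * x 1 * conj (y 0) * conj (y 1))) /
        ((Real.pi : ℂ) ^ 2 *
          ((1 - x 0 * conj (y 0)) * (1 - x 1 * conj (y 1)) *
            (1 - x 0 * conj (y 1)) * (1 - x 1 * conj (y 0))) ^ 2) := by
  rw [symmetrizedBidiscKernel, symmetrizedBidiscDenom_symmetrization]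
  simp only [symmetrization_two_zero, symmetrization_two_one, map_add, map_mul]
  congr 1
  ring

theorem one_sub_le_norm_one_sub_mul_conj {a b : ℂ} (ha : ‖a‖ ≤ 1) {r : ℝ} (hb : ‖b‖ ≤ r) :
    1 - r ≤ ‖1 - a * conj b‖ := by
  have := norm_sub_norm_le (1 : ℂ) (a * conj b)
  rw [norm_one, norm_mul, RCLike.norm_conj] at this
  nlinarith [norm_nonneg b]

/-- A lower bound for the denominator which is uniform in the first variable. -/
theorem le_norm_symmetrizedBidiscDenom {x y : Fin 2 → ℂ} (hx : x ∈ polydisc 2) {r : ℝ}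
    (hr : r < 1) (hy : ∀ i, ‖y i‖ ≤ r) :
    (1 - r) ^ 4 ≤ ‖symmetrizedBidiscDenom (symmetrization 2 x) (symmetrization 2 y)‖ := by
  rw [symmetrizedBidiscDenom_symmetrization, norm_mul, norm_mul, norm_mul,
    show (1 - r) ^ 4 = (1 - r) * (1 - r) * (1 - r) * (1 - r) by ring]
  have h0 : 0 ≤ 1 - r := by linarith
  have h := fun i j => one_sub_le_norm_one_sub_mul_conj (hx i).le (hy j)
  gcongr <;> apply h

theorem exists_norm_le_of_mem_polydisc {n : ℕ} {y : Fin n → ℂ} (hy : y ∈ polydisc n) :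
    ∃ r < 1, ∀ i, ‖y i‖ ≤ r := by
  refine ⟨‖y‖, ?_, fun i => norm_le_pi_norm y i⟩
  rwa [polydisc_eq_ball, mem_ball_zero_iff] at hy

theorem symmetrizedBidiscDenom_ne_zero {z w : Fin 2 → ℂ} (hz : z ∈ symmetrizedPolydisc 2)
    (hw : w ∈ symmetrizedPolydisc 2) : symmetrizedBidiscDenom z w ≠ 0 := by
  obtain ⟨x, hx, rfl⟩ := hz
  obtain ⟨y, hy, rfl⟩ := hw
  obtain ⟨r, hr, hyr⟩ := exists_norm_le_of_mem_polydisc hy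
  rw [← norm_pos_iff]
  exact (pow_pos (sub_pos.mpr hr) 4).trans_le (le_norm_symmetrizedBidiscDenom hx hr hyr)

/-- The numerator equals (1 - x₀ȳ₀)(1 - x₁ȳ₁) + (1 - x₀ȳ₁)(1 - x₁ȳ₀). -/
theorem symmetrizedBidiscKernel_ne_zero {z w : Fin 2 → ℂ} (hz : z ∈ symmetrizedPolydisc 2)
    (hw : w ∈ symmetrizedPolydisc 2) : symmetrizedBidiscKernel z w ≠ 0 := by
  have hden := symmetrizedBidiscDenom_ne_zero hz hw
  obtain ⟨x, hx, rfl⟩ := hz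
  obtain ⟨y, hy, rfl⟩ := hw
  refine div_ne_zero ?_ (mul_ne_zero (pow_ne_zero 2 ?_) (pow_ne_zero 2 hden))
  · have h := one_sub_mul_mul_add_ne_zero (hx 0) (hx 1) (v := conj (y 0)) (w := conj (y 1))
      (by simpa using hy 0) (by simpa using hy 1)
    convert h using 1
    simp only [symmetrization_two_zero, symmetrization_two_one, map_add, map_mul]
    ring
  · exact_mod_cast Real.pi_ne_zero

/-- The kernel is bounded in the first variable, locally uniformly in the second variable. -/
theorem norm_symmetrizedBidiscKernel_le {z y : Fin 2 → ℂ} (hz : z ∈ symmetrizedPolydisc 2) {r : ℝ}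
    (hr : r < 1) (hy : ∀ i, ‖y i‖ ≤ r) :
    ‖symmetrizedBidiscKernel z (symmetrization 2 y)‖ ≤
      8 / (Real.pi ^ 2 * ((1 - r) ^ 4) ^ 2) := by
  obtain ⟨x, hx, rfl⟩ := hz
  have hden := le_norm_symmetrizedBidiscDenom hx hr hy
  have hpos : 0 < (1 - r) ^ 4 := pow_pos (sub_pos.mpr hr) 4
  rw [symmetrizedBidiscKernel, norm_div, norm_mul, norm_pow, norm_pow, Complex.norm_real,
    Real.norm_of_nonneg Real.pi_pos.le]
  refine div_le_div₀ (by norm_num) ?_ (by positivity) (by gcongr)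
  have hx0 := (hx 0).le
  have hx1 := (hx 1).le
  have hy0 := (hy 0).trans hr.le
  have hy1 := (hy 1).trans hr.le
  rw [symmetrization_two_zero, symmetrization_two_one, symmetrization_two_zero,
    symmetrization_two_one]
  have ha : ‖conj (y 0 + y 1) * (x 0 + x 1)‖ ≤ 2 * 2 := by
    rw [norm_mul, RCLike.norm_conj]
    gcongr
    · exact (norm_add_le _ _).trans (by linarith)
    · exact (norm_add_le _ _).trans (by linarith)
  have hb : ‖2 * (x 0 * x 1 * conj (y 0 * y 1))‖ ≤ 2 * (1 * 1 * (1 * 1)) := by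
    rw [norm_mul, norm_mul, norm_mul, RCLike.norm_conj, norm_mul, Complex.norm_two]
    gcongr
  calc _ ≤ ‖(2 : ℂ)‖ + ‖conj (y 0 + y 1) * (x 0 + x 1)‖ +
        ‖2 * (x 0 * x 1 * conj (y 0 * y 1))‖ :=
        (norm_add_le _ _).trans (add_le_add_left (norm_sub_le _ _) _)
    _ ≤ 8 := by rw [Complex.norm_two]; linarith

theorem differentiableOn_symmetrizedBidiscKernel {w : Fin 2 → ℂ}
    (hw : w ∈ symmetrizedPolydisc 2) :
    DifferentiableOn ℂ (fun z => symmetrizedBidiscKernel z w) (symmetrizedPolydisc 2) := by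
  have hn : Differentiable ℂ fun z : Fin 2 → ℂ =>
      2 - conj (w 0) * z 0 + 2 * (z 1 * conj (w 1)) := by fun_prop
  have hd : Differentiable ℂ fun z : Fin 2 → ℂ =>
      (Real.pi : ℂ) ^ 2 * symmetrizedBidiscDenom z w ^ 2 := by
    unfold symmetrizedBidiscDenom; fun_prop
  simp only [symmetrizedBidiscKernel, div_eq_mul_inv]
  exact hn.differentiableOn.mul (hd.differentiableOn.fun_inv fun z hz =>
    mul_ne_zero (pow_ne_zero 2 (by exact_mod_cast Real.pi_ne_zero))
      (pow_ne_zero 2 (symmetrizedBidiscDenom_ne_zero hz hw)))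

theorem memLp_symmetrizedBidiscKernel {w : Fin 2 → ℂ} (hw : w ∈ symmetrizedPolydisc 2) :
    MemLp (fun z => symmetrizedBidiscKernel z w) 2 (volume.restrict (symmetrizedPolydisc 2)) := by
  have hms := isOpen_symmetrizedPolydisc_two.measurableSet
  have : IsFiniteMeasure (volume.restrict (symmetrizedPolydisc 2)) :=
    ⟨by rw [Measure.restrict_apply_univ]; exact isBounded_symmetrizedPolydisc_two.measure_lt_top⟩
  have hd := differentiableOn_symmetrizedBidiscKernel hw
  obtain ⟨y, hy, rfl⟩ := hw
  obtain ⟨r, hr, hyr⟩ := exists_norm_le_of_mem_polydisc hy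
  exact MemLp.of_bound (hd.continuousOn.aestronglyMeasurable hms) _
    ((ae_restrict_mem hms).mono fun z hz => norm_symmetrizedBidiscKernel_le hz hr hyr)

/-! ### Change of variables under symmetrization. -/

/-- The derivative of the symmetrization map of `ℂ²`. -/
noncomputable def symmetrizationTwoDeriv (x : Fin 2 → ℂ) : (Fin 2 → ℂ) →L[ℂ] (Fin 2 → ℂ) :=
  LinearMap.toContinuousLinearMap (Matrix.toLin' !![1, 1; x 1, x 0])

theorem hasFDerivAt_symmetrization_two (x : Fin 2 → ℂ) :
    HasFDerivAt (symmetrization 2) (symmetrizationTwoDeriv x) x := by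
  have h0 : HasFDerivAt (fun y : Fin 2 → ℂ => y 0)
    (ContinuousLinearMap.proj (R := ℂ) (φ := fun _ : Fin 2 => ℂ) 0) x := hasFDerivAt_apply 0 x
  have h1 : HasFDerivAt (fun y : Fin 2 → ℂ => y 1)
    (ContinuousLinearMap.proj (R := ℂ) (φ := fun _ : Fin 2 => ℂ) 1) x := hasFDerivAt_apply 1 x
  rw [hasFDerivAt_pi']
  intro i
  fin_cases i
  · simp only [Fin.zero_eta, symmetrization_two_zero]
    refine (h0.add h1).congr_fderiv (ContinuousLinearMap.ext fun v => ?_)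
    simp [symmetrizationTwoDeriv, dotProduct, Fin.sum_univ_two]
  · simp only [Fin.mk_one, symmetrization_two_one]
    refine (h0.mul h1).congr_fderiv (ContinuousLinearMap.ext fun v => ?_)
    simp [symmetrizationTwoDeriv, dotProduct, Fin.sum_univ_two]
    ring

/-- The real determinant of a complex-linear map is the squared modulus of its complex determinant.
-/
theorem abs_det_symmetrizationTwoDeriv (x : Fin 2 → ℂ) :
    |((symmetrizationTwoDeriv x).restrictScalars ℝ).det| = ‖x 0 - x 1‖ ^ 2 := by
  have h : ((symmetrizationTwoDeriv x).restrictScalars ℝ).det =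
      Algebra.norm ℝ (LinearMap.det (Matrix.toLin' !![1, 1; x 1, x 0])) := by
    rw [← LinearMap.det_restrictScalars]
    rfl
  rw [h, LinearMap.det_toLin', Matrix.det_fin_two_of, Algebra.norm_complex_apply, one_mul, one_mul,
    Complex.normSq_eq_norm_sq, abs_of_nonneg (by positivity)]

/-- This real hyperplane is the wall separating two halves of the bidisc exchanged by the swap; a
proper real subspace is null. -/
theorem volume_setOf_re_eq_re : volume {x : Fin 2 → ℂ | (x 0).re = (x 1).re} = 0 := by
  let l : (Fin 2 → ℂ) →ₗ[ℝ] ℝ :=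
    Complex.reLm ∘ₗ (LinearMap.proj (R := ℝ) (φ := fun _ : Fin 2 => ℂ) 0) -
      Complex.reLm ∘ₗ (LinearMap.proj (R := ℝ) (φ := fun _ : Fin 2 => ℂ) 1)
  have hl : {x : Fin 2 → ℂ | (x 0).re = (x 1).re} = (LinearMap.ker l : Set (Fin 2 → ℂ)) := by
    ext x
    simp [l, sub_eq_zero]
  rw [hl]
  refine Measure.addHaar_submodule _ _ fun h => ?_
  have : (![1, 0] : Fin 2 → ℂ) ∈ LinearMap.ker l := by rw [h]; trivial
  simp [l] at this

/-- The part of the bidisc where the real parts of the coordinates are increasing. -/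
def orderedBidisc : Set (Fin 2 → ℂ) :=
  {x | x ∈ polydisc 2 ∧ (x 0).re < (x 1).re}

theorem isOpen_polydisc (n : ℕ) : IsOpen (polydisc n) := by
  rw [polydisc_eq_ball]; exact Metric.isOpen_ball

theorem measurableSet_orderedBidisc : MeasurableSet orderedBidisc :=
  ((isOpen_polydisc 2).inter
    (isOpen_lt (by fun_prop : Continuous fun x : Fin 2 → ℂ => (x 0).re)
      (by fun_prop))).measurableSet

/-- Exchanging the two coordinates. -/
noncomputable def coordSwap : (Fin 2 → ℂ) ≃ᵐ (Fin 2 → ℂ) :=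
  MeasurableEquiv.piCongrLeft (fun _ => ℂ) (Equiv.swap 0 1)

theorem coordSwap_zero (x : Fin 2 → ℂ) : coordSwap x 0 = x 1 := by
  have := MeasurableEquiv.piCongrLeft_apply_apply (β := fun _ : Fin 2 => ℂ) (Equiv.swap 0 1) x 1
  simpa [coordSwap] using this

theorem coordSwap_one (x : Fin 2 → ℂ) : coordSwap x 1 = x 0 := by
  have := MeasurableEquiv.piCongrLeft_apply_apply (β := fun _ : Fin 2 => ℂ) (Equiv.swap 0 1) x 0
  simpa [coordSwap] using this

theorem measurePreserving_coordSwap : MeasurePreserving coordSwap volume volume :=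
  volume_measurePreserving_piCongrLeft (fun _ => ℂ) (Equiv.swap 0 1)

theorem coordSwap_mem_polydisc {x : Fin 2 → ℂ} : coordSwap x ∈ polydisc 2 ↔ x ∈ polydisc 2 := by
  rw [mem_polydisc_two, mem_polydisc_two, coordSwap_zero, coordSwap_one, and_comm]

theorem symmetrization_coordSwap (x : Fin 2 → ℂ) :
    symmetrization 2 (coordSwap x) = symmetrization 2 x := by
  rw [symmetrization_two, symmetrization_two, coordSwap_zero, coordSwap_one, add_comm, mul_comm]

/-- Sum and product determine the unordered pair of roots, and the strict order of real parts
selects one ordering. -/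
theorem injOn_symmetrization_orderedBidisc : Set.InjOn (symmetrization 2) orderedBidisc := by
  intro x hx y hy h
  have h0 := congrFun h 0
  have h1 := congrFun h 1
  rw [symmetrization_two_zero, symmetrization_two_zero] at h0
  rw [symmetrization_two_one, symmetrization_two_one] at h1
  have h2 : (x 0 - y 0) * (x 0 - y 1) = 0 := by linear_combination x 0 * h0 - h1
  rcases mul_eq_zero.mp h2 with h3 | h3
  · funext i
    fin_cases i
    · exact sub_eq_zero.mp h3
    · simp only [Fin.mk_one]; linear_combination h0 - h3
  · have h4 : x 1 = y 0 := by linear_combination h0 - h3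
    have := hx.2
    rw [sub_eq_zero.mp h3, h4] at this
    exact absurd this hy.2.not_gt

/-- After swapping coordinates if necessary, only images of wall points are missed, and a
differentiable map sends null sets to null sets. -/
theorem image_orderedBidisc_ae_eq :
    symmetrization 2 '' orderedBidisc =ᵐ[volume] symmetrizedPolydisc 2 := by
  have hsub : symmetrization 2 '' orderedBidisc ⊆ symmetrizedPolydisc 2 :=
    Set.image_mono fun x hx => hx.1
  have hnull : volume (symmetrization 2 '' {x | (x 0).re = (x 1).re}) = 0 :=
    addHaar_image_eq_zero_of_differentiableOn_of_addHaar_eq_zero volume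
      (differentiable_symmetrization_two.restrictScalars ℝ).differentiableOn
      volume_setOf_re_eq_re
  refine hsub.eventuallyLE.antisymm ?_
  rw [ae_le_set]
  refine measure_mono_null ?_ hnull
  rintro _ ⟨⟨x, hx, rfl⟩, hn⟩
  rcases lt_trichotomy (x 0).re (x 1).re with h | h | h
  · exact absurd ⟨x, ⟨hx, h⟩, rfl⟩ hn
  · exact ⟨x, h, rfl⟩
  · refine absurd ⟨coordSwap x, ⟨coordSwap_mem_polydisc.mpr hx, ?_⟩,
      symmetrization_coordSwap x⟩ hn
    rwa [coordSwap_zero, coordSwap_one]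

theorem polydisc_two_ae_eq :
    (orderedBidisc ∪ coordSwap ⁻¹' orderedBidisc : Set (Fin 2 → ℂ)) =ᵐ[volume] polydisc 2 := by
  have hsub : (orderedBidisc ∪ coordSwap ⁻¹' orderedBidisc) ⊆ polydisc 2 :=
    Set.union_subset (fun x hx => hx.1) fun x hx => coordSwap_mem_polydisc.mp hx.1
  refine hsub.eventuallyLE.antisymm ?_
  rw [ae_le_set]
  refine measure_mono_null ?_ volume_setOf_re_eq_re
  rintro x ⟨hx, hn⟩
  rcases lt_trichotomy (x 0).re (x 1).re with h | h | h
  · exact absurd (Or.inl ⟨hx, h⟩) hn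
  · exact h
  · refine absurd (Or.inr ⟨coordSwap_mem_polydisc.mpr hx, ?_⟩) hn
    rwa [coordSwap_zero, coordSwap_one]

theorem disjoint_orderedBidisc : Disjoint orderedBidisc (coordSwap ⁻¹' orderedBidisc) := by
  rw [Set.disjoint_left]
  rintro x hx ⟨_, hx'⟩
  rw [coordSwap_zero, coordSwap_one] at hx'
  exact hx.2.not_gt hx'

section Symmetric

variable {E : Type*} [NormedAddCommGroup E] {h : (Fin 2 → ℂ) → E}

theorem integrableOn_coordSwap_preimage (hs : ∀ x, h (coordSwap x) = h x)
    (hi : IntegrableOn h orderedBidisc) :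
    IntegrableOn h (coordSwap ⁻¹' orderedBidisc) := by
  have := (measurePreserving_coordSwap.integrableOn_comp_preimage
    coordSwap.measurableEmbedding).mpr hi
  rwa [show h ∘ coordSwap = h from funext hs] at this

theorem integrableOn_polydisc_two_of_symmetric (hs : ∀ x, h (coordSwap x) = h x)
    (hi : IntegrableOn h orderedBidisc) : IntegrableOn h (polydisc 2) :=
  (hi.union (integrableOn_coordSwap_preimage hs hi)).congr_set_ae polydisc_two_ae_eq.symm

theorem integral_polydisc_two_of_symmetric [NormedSpace ℝ E] (hs : ∀ x, h (coordSwap x) = h x)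
    (hi : IntegrableOn h orderedBidisc) :
    ∫ x in polydisc 2, h x = (2 : ℝ) • ∫ x in orderedBidisc, h x := by
  have h1 : ∫ x in coordSwap ⁻¹' orderedBidisc, h x = ∫ x in orderedBidisc, h x := by
    have := measurePreserving_coordSwap.setIntegral_preimage_emb coordSwap.measurableEmbedding h
      orderedBidisc
    simpa only [hs] using this
  rw [← setIntegral_congr_set polydisc_two_ae_eq, setIntegral_union disjoint_orderedBidisc
    (coordSwap.measurable measurableSet_orderedBidisc) hi (integrableOn_coordSwap_preimage hs hi),
    h1, two_smul]

variable {g : (Fin 2 → ℂ) → E} [NormedSpace ℝ E]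

theorem integrableOn_orderedBidisc (hg : IntegrableOn g (symmetrizedPolydisc 2)) :
    IntegrableOn (fun x => ‖x 0 - x 1‖ ^ 2 • g (symmetrization 2 x)) orderedBidisc := by
  have := (integrableOn_image_iff_integrableOn_abs_det_fderiv_smul volume
    measurableSet_orderedBidisc
    (fun x _ => ((hasFDerivAt_symmetrization_two x).restrictScalars ℝ).hasFDerivWithinAt)
    injOn_symmetrization_orderedBidisc g).mp (hg.congr_set_ae image_orderedBidisc_ae_eq)
  simpa only [abs_det_symmetrizationTwoDeriv] using this

theorem smul_comp_symmetrization_coordSwap (x : Fin 2 → ℂ) :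
    ‖coordSwap x 0 - coordSwap x 1‖ ^ 2 • g (symmetrization 2 (coordSwap x)) =
      ‖x 0 - x 1‖ ^ 2 • g (symmetrization 2 x) := by
  rw [symmetrization_coordSwap, coordSwap_zero, coordSwap_one, norm_sub_rev]

/-- The change of variables `z = symmetrization 2 x`: integrability. -/
theorem integrableOn_polydisc_two_comp_symmetrization
    (hg : IntegrableOn g (symmetrizedPolydisc 2)) :
    IntegrableOn (fun x => ‖x 0 - x 1‖ ^ 2 • g (symmetrization 2 x)) (polydisc 2) :=
  integrableOn_polydisc_two_of_symmetric smul_comp_symmetrization_coordSwap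
    (integrableOn_orderedBidisc hg)

/-- The change of variables `z = symmetrization 2 x`. -/
theorem integral_polydisc_two_comp_symmetrization
    (hg : IntegrableOn g (symmetrizedPolydisc 2)) :
    ∫ x in polydisc 2, ‖x 0 - x 1‖ ^ 2 • g (symmetrization 2 x) =
      (2 : ℝ) • ∫ z in symmetrizedPolydisc 2, g z := by
  rw [integral_polydisc_two_of_symmetric smul_comp_symmetrization_coordSwap
    (integrableOn_orderedBidisc hg), ← setIntegral_congr_set image_orderedBidisc_ae_eq,
    integral_image_eq_integral_abs_det_fderiv_smul volume measurableSet_orderedBidisc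
    (fun x _ => ((hasFDerivAt_symmetrization_two x).restrictScalars ℝ).hasFDerivWithinAt)
    injOn_symmetrization_orderedBidisc]
  simp only [abs_det_symmetrizationTwoDeriv]

end Symmetric

/-! ### The reproducing property on the symmetrized bidisc. -/

section Reproducing

variable {f : (Fin 2 → ℂ) → ℂ}

theorem differentiableOn_sub_mul_comp_symmetrization
    (hf : f ∈ bergmanSpace (symmetrizedPolydisc 2)) :
    DifferentiableOn ℂ (fun x => (x 0 - x 1) * f (symmetrization 2 x)) (polydisc 2) :=
  DifferentiableOn.mul (Differentiable.differentiableOn (by fun_prop))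
    (hf.1.comp differentiable_symmetrization_two.differentiableOn (Set.mapsTo_image _ _))

/-- The squared modulus is the pullback of |f|² with its real Jacobian, so the function is in L²,
hence in L¹ because the bidisc has finite measure. -/
theorem integrableOn_sub_mul_comp_symmetrization
    (hf : f ∈ bergmanSpace (symmetrizedPolydisc 2)) :
    IntegrableOn (fun x => (x 0 - x 1) * f (symmetrization 2 x)) (polydisc 2) := by
  have hms := (isOpen_polydisc 2).measurableSet
  have : IsFiniteMeasure (volume.restrict (polydisc 2)) :=
    ⟨by rw [Measure.restrict_apply_univ, polydisc_eq_ball]; exact measure_ball_lt_top⟩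
  have hm : AEStronglyMeasurable (fun x : Fin 2 → ℂ => (x 0 - x 1) * f (symmetrization 2 x))
      (volume.restrict (polydisc 2)) :=
    (differentiableOn_sub_mul_comp_symmetrization hf).continuousOn.aestronglyMeasurable hms
  have h2 : MemLp (fun x : Fin 2 → ℂ => (x 0 - x 1) * f (symmetrization 2 x)) 2
      (volume.restrict (polydisc 2)) := by
    rw [memLp_two_iff_integrable_sq_norm hm]
    simp only [norm_mul, mul_pow]
    exact integrableOn_polydisc_two_comp_symmetrization (hf.2.integrable_norm_pow two_ne_zero)
  exact h2.integrable one_le_two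

theorem integrableOn_mul_conj_symmetrizedBidiscKernel
    (hf : f ∈ bergmanSpace (symmetrizedPolydisc 2)) {w : Fin 2 → ℂ}
    (hw : w ∈ symmetrizedPolydisc 2) :
    IntegrableOn (fun z => f z * conj (symmetrizedBidiscKernel z w)) (symmetrizedPolydisc 2) :=
  hf.2.integrable_mul (memLp_symmetrizedBidiscKernel hw).star

/-- The relation between the kernel of the symmetrized bidisc and the antisymmetrized kernel of the
bidisc. -/
theorem sub_mul_sub_mul_conj_symmetrizedBidiscKernel {x y : Fin 2 → ℂ} (hx : x ∈ polydisc 2)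
    (hy : y ∈ polydisc 2) :
    (y 0 - y 1) * (conj (x 0 - x 1) *
        conj (symmetrizedBidiscKernel (symmetrization 2 x) (symmetrization 2 y))) =
      ((Real.pi : ℂ) ^ 2)⁻¹ *
        (((1 - conj (x 0) * y 0) ^ 2)⁻¹ * ((1 - conj (x 1) * y 1) ^ 2)⁻¹ -
          ((1 - conj (x 0) * y 1) ^ 2)⁻¹ * ((1 - conj (x 1) * y 0) ^ 2)⁻¹) := by
  have h := fun i j => one_sub_conj_mul_ne_zero (hx i).le (hy j)
  have h00 := h 0 0
  have h01 := h 0 1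
  have h10 := h 1 0
  have h11 := h 1 1
  have hpi : (Real.pi : ℂ) ≠ 0 := by exact_mod_cast Real.pi_ne_zero
  rw [symmetrizedBidiscKernel_symmetrization]
  simp only [map_div₀, map_mul, map_sub, map_add, map_pow, map_one, map_ofNat, Complex.conj_conj,
    Complex.conj_ofReal]
  generalize conj (x 0) = a at *
  generalize conj (x 1) = b at *
  -- Difference of squares: the two products on the right differ by (y₀ - y₁)(a - b), and their sum
  -- is the numerator of the kernel.
  have key : (y 0 - y 1) * (a - b) * (2 - (y 0 + y 1) * (a + b) + 2 * (a * b * y 0 * y 1)) =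
      ((1 - a * y 1) * (1 - b * y 0)) ^ 2 - ((1 - a * y 0) * (1 - b * y 1)) ^ 2 := by ring
  rw [← mul_assoc, ← mul_div_assoc, key]
  generalize 1 - a * y 0 = p at *
  generalize 1 - a * y 1 = q at *
  generalize 1 - b * y 0 = r at *
  generalize 1 - b * y 1 = s at *
  field_simp

/-- The reproducing property at the image of a point with distinct coordinates. -/
theorem integral_mul_conj_symmetrizedBidiscKernel_of_ne
    (hf : f ∈ bergmanSpace (symmetrizedPolydisc 2)) {y : Fin 2 → ℂ} (hy : y ∈ polydisc 2)
    (hne : y 0 ≠ y 1) :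
    ∫ z in symmetrizedPolydisc 2, f z * conj (symmetrizedBidiscKernel z (symmetrization 2 y)) =
      f (symmetrization 2 y) := by
  set F : (Fin 2 → ℂ) → ℂ := fun x => (x 0 - x 1) * f (symmetrization 2 x) with hF
  have hFd : DifferentiableOn ℂ F (polydisc 2) := differentiableOn_sub_mul_comp_symmetrization hf
  have hFi : IntegrableOn F (polydisc 2) := integrableOn_sub_mul_comp_symmetrization hf
  have hms := (isOpen_polydisc 2).measurableSet
  have hy' := coordSwap_mem_polydisc.mpr hy
  have hJ : y 0 - y 1 ≠ 0 := sub_ne_zero.mpr hne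
  have hpi : (Real.pi : ℂ) ≠ 0 := by exact_mod_cast Real.pi_ne_zero
  have hki : ∀ u ∈ polydisc 2, IntegrableOn (fun x : Fin 2 → ℂ =>
      F x * (((1 - conj (x 0) * u 0) ^ 2)⁻¹ * ((1 - conj (x 1) * u 1) ^ 2)⁻¹))
      (polydisc 2) := by
    intro u hu
    have hc : ∀ i, ContinuousOn (fun x : Fin 2 → ℂ => ((1 - conj (x i) * u i) ^ 2)⁻¹)
        (polydisc 2) := fun i =>
      (continuousOn_inv_one_sub_conj_mul_sq (hu i)).comp (continuous_apply i).continuousOn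
        fun x hx => mem_closedBall_zero_iff.mpr (hx i).le
    refine Integrable.mul_bdd hFi (c := ((1 - ‖u 0‖) ^ 2)⁻¹ * ((1 - ‖u 1‖) ^ 2)⁻¹)
      (((hc 0).mul (hc 1)).aestronglyMeasurable hms) ((ae_restrict_mem hms).mono fun x hx => ?_)
    rw [norm_mul]
    exact mul_le_mul (norm_inv_one_sub_conj_mul_sq_le (hx 0).le (hu 0))
      (norm_inv_one_sub_conj_mul_sq_le (hx 1).le (hu 1)) (norm_nonneg _) (by positivity)
  have hcv := integral_polydisc_two_comp_symmetrization
    (integrableOn_mul_conj_symmetrizedBidiscKernel hf ⟨y, hy, rfl⟩)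
  have hpt : ∀ x ∈ polydisc 2, ‖x 0 - x 1‖ ^ 2 • (f (symmetrization 2 x) *
      conj (symmetrizedBidiscKernel (symmetrization 2 x) (symmetrization 2 y))) =
      ((y 0 - y 1)⁻¹ * ((Real.pi : ℂ) ^ 2)⁻¹) *
        (F x * (((1 - conj (x 0) * y 0) ^ 2)⁻¹ * ((1 - conj (x 1) * y 1) ^ 2)⁻¹) -
        F x * (((1 - conj (x 0) * coordSwap y 0) ^ 2)⁻¹ *
          ((1 - conj (x 1) * coordSwap y 1) ^ 2)⁻¹)) := by
    intro x hx
    have hk := sub_mul_sub_mul_conj_symmetrizedBidiscKernel hx hy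
    have hn : ((‖x 0 - x 1‖ ^ 2 : ℝ) : ℂ) = (x 0 - x 1) * conj (x 0 - x 1) := by
      rw [RCLike.mul_conj]; push_cast; rfl
    rw [Complex.real_smul, hn, coordSwap_zero, coordSwap_one]
    simp only [hF]
    linear_combination ((y 0 - y 1)⁻¹ * ((x 0 - x 1) * f (symmetrization 2 x))) * hk -
      ((x 0 - x 1) * conj (x 0 - x 1) * (f (symmetrization 2 x) *
        conj (symmetrizedBidiscKernel (symmetrization 2 x) (symmetrization 2 y)))) *
        inv_mul_cancel₀ hJ
  rw [setIntegral_congr_fun hms hpt, integral_const_mul, integral_sub (hki y hy) (hki _ hy'),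
    integral_polydisc_two_bergman hFd hFi hy, integral_polydisc_two_bergman hFd hFi hy'] at hcv
  -- By antisymmetry the two reproduced values combine to 2F(y), cancelling the 2 from the
  -- two-sheeted change of variables.
  have hFs : F (coordSwap y) = -F y := by
    simp only [hF, symmetrization_coordSwap, coordSwap_zero, coordSwap_one]; ring
  have hFy : F y = (y 0 - y 1) * f (symmetrization 2 y) := rfl
  rw [hFs, hFy, Complex.real_smul] at hcv
  field_simp at hcv
  push_cast at hcv
  linear_combination -hcv / 2

open Filter Topology in
/-- The integral against the kernel depends continuously on the point. -/
theorem continuousAt_integral_mul_conj_symmetrizedBidiscKernel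
    (hf : f ∈ bergmanSpace (symmetrizedPolydisc 2)) {y : Fin 2 → ℂ} (hy : y ∈ polydisc 2) :
    ContinuousAt (fun u => ∫ z in symmetrizedPolydisc 2,
      f z * conj (symmetrizedBidiscKernel z (symmetrization 2 u))) y := by
  have hms := isOpen_symmetrizedPolydisc_two.measurableSet
  have : IsFiniteMeasure (volume.restrict (symmetrizedPolydisc 2)) :=
    ⟨by rw [Measure.restrict_apply_univ]; exact isBounded_symmetrizedPolydisc_two.measure_lt_top⟩
  have hfi : IntegrableOn f (symmetrizedPolydisc 2) := hf.2.integrable one_le_two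
  rw [polydisc_eq_ball, mem_ball_zero_iff] at hy
  obtain ⟨r, hyr, hr⟩ := exists_between hy
  have hnear : ∀ᶠ u : Fin 2 → ℂ in 𝓝 y, ∀ i, ‖u i‖ ≤ r :=
    (continuous_norm.continuousAt.eventually (gt_mem_nhds hyr)).mono
      fun u hu i => (norm_le_pi_norm u i).trans (le_of_lt hu)
  have hmem : ∀ u : Fin 2 → ℂ, (∀ i, ‖u i‖ ≤ r) → symmetrization 2 u ∈ symmetrizedPolydisc 2 :=
    fun u hu => ⟨u, fun i => (hu i).trans_lt hr, rfl⟩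
  refine continuousAt_of_dominated (bound := fun z =>
    ‖f z‖ * (8 / (Real.pi ^ 2 * ((1 - r) ^ 4) ^ 2))) ?_ ?_ (hfi.norm.mul_const _) ?_
  · filter_upwards [hnear] with u hu
    exact (integrableOn_mul_conj_symmetrizedBidiscKernel hf (hmem u hu)).aestronglyMeasurable
  · filter_upwards [hnear] with u hu
    filter_upwards [ae_restrict_mem hms] with z hz
    rw [norm_mul, RCLike.norm_conj]
    exact mul_le_mul_of_nonneg_left (norm_symmetrizedBidiscKernel_le hz hr hu) (norm_nonneg _)
  · filter_upwards [ae_restrict_mem hms] with z hz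
    have hs : Continuous (symmetrization 2) := differentiable_symmetrization_two.continuous
    refine continuousAt_const.mul (Complex.continuous_conj.continuousAt.comp ?_)
    unfold symmetrizedBidiscKernel
    refine ContinuousAt.div (Continuous.continuousAt (by fun_prop))
      (Continuous.continuousAt (by unfold symmetrizedBidiscDenom; fun_prop)) ?_
    exact mul_ne_zero (pow_ne_zero 2 (by exact_mod_cast Real.pi_ne_zero)) (pow_ne_zero 2
      (symmetrizedBidiscDenom_ne_zero hz (hmem y fun i => (norm_le_pi_norm y i).trans hyr.le)))

open Filter Topology in
/-- The reproducing property of the kernel of the symmetrized bidisc. -/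
theorem integral_mul_conj_symmetrizedBidiscKernel
    (hf : f ∈ bergmanSpace (symmetrizedPolydisc 2)) {y : Fin 2 → ℂ} (hy : y ∈ polydisc 2) :
    ∫ z in symmetrizedPolydisc 2, f z * conj (symmetrizedBidiscKernel z (symmetrization 2 y)) =
      f (symmetrization 2 y) := by
  by_cases hne : y 0 = y 1
  swap
  · exact integral_mul_conj_symmetrizedBidiscKernel_of_ne hf hy hne
  -- A path leaving the diagonal: for ε ≠ 0 the coordinates differ and the previous case applies.
  let u : ℂ → Fin 2 → ℂ := fun ε => ![y 0, y 1 + ε]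
  have hu0 : u 0 = y := by
    funext i; fin_cases i <;> simp [u]
  have huc : Continuous u := by
    refine continuous_pi fun i => ?_
    fin_cases i
    · exact continuous_const
    · exact continuous_const.add continuous_id
  have hut : Tendsto u (𝓝[≠] 0) (𝓝 y) := by
    have := huc.tendsto 0
    rw [hu0] at this
    exact this.mono_left nhdsWithin_le_nhds
  have h1 := (continuousAt_integral_mul_conj_symmetrizedBidiscKernel hf hy).tendsto.comp hut
  have hfc : ContinuousAt (fun u => f (symmetrization 2 u)) y :=
    ContinuousAt.comp (f := symmetrization 2)
      (hf.1.continuousOn.continuousAt (isOpen_symmetrizedPolydisc_two.mem_nhds ⟨y, hy, rfl⟩))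
      differentiable_symmetrization_two.continuous.continuousAt
  have h2 := hfc.tendsto.comp hut
  refine tendsto_nhds_unique h1 (h2.congr' ?_)
  filter_upwards [hut.eventually ((isOpen_polydisc 2).mem_nhds hy), self_mem_nhdsWithin]
    with ε hε hε0
  refine (integral_mul_conj_symmetrizedBidiscKernel_of_ne hf hε ?_).symm
  intro h
  apply hε0
  have h' : y 0 = y 1 + ε := h
  rw [hne] at h'
  simpa using h'

end Reproducing

/-! ### Identification of the Bergman kernel. -/

theorem isBergmanKernel_symmetrizedBidiscKernel :
    IsBergmanKernel (symmetrizedPolydisc 2) symmetrizedBidiscKernel where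
  mem_bergmanSpace w hw :=
    ⟨differentiableOn_symmetrizedBidiscKernel hw, memLp_symmetrizedBidiscKernel hw⟩
  reproducing f hf w hw := by
    obtain ⟨y, hy, rfl⟩ := hw
    exact (integral_mul_conj_symmetrizedBidiscKernel hf hy).symm

/-- The choice made by `Classical.epsilon` is a kernel because an explicit one exists; uniqueness on
open sets then identifies the two. -/
theorem isBergmanKernel_bergmanKernel_symmetrizedBidisc :
    IsBergmanKernel (symmetrizedPolydisc 2) (bergmanKernel (symmetrizedPolydisc 2)) :=
  Classical.epsilon_spec ⟨_, isBergmanKernel_symmetrizedBidiscKernel⟩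

theorem bergmanKernel_symmetrizedBidisc_eq {z w : Fin 2 → ℂ} (hz : z ∈ symmetrizedPolydisc 2)
    (hw : w ∈ symmetrizedPolydisc 2) :
    bergmanKernel (symmetrizedPolydisc 2) z w = symmetrizedBidiscKernel z w :=
  isBergmanKernel_bergmanKernel_symmetrizedBidisc.eq_of_isOpen isOpen_symmetrizedPolydisc_two
    isBergmanKernel_symmetrizedBidiscKernel hz hw

theorem mainTheorem5 :
    IsBergmanKernel (symmetrizedPolydisc 2) (bergmanKernel (symmetrizedPolydisc 2)) ∧
    (∀ x ∈ polydisc 2, ∀ y ∈ polydisc 2,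
      bergmanKernel (symmetrizedPolydisc 2) (symmetrization 2 x) (symmetrization 2 y) =
        (2 - (conj (y 0) + conj (y 1)) * (x 0 + x 1)
            + 2 * (x 0 * x 1 * conj (y 0) * conj (y 1))) /
          ((Real.pi : ℂ) ^ 2 *
            ((1 - x 0 * conj (y 0)) * (1 - x 1 * conj (y 1)) *
              (1 - x 0 * conj (y 1)) * (1 - x 1 * conj (y 0))) ^ 2)) ∧
    IsLuQiKengDomain (symmetrizedPolydisc 2) := by
  refine ⟨isBergmanKernel_bergmanKernel_symmetrizedBidisc, fun x hx y hy => ?_,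
    isOpen_symmetrizedPolydisc_two, isConnected_symmetrizedPolydisc_two, fun z hz w hw => ?_⟩
  · rw [bergmanKernel_symmetrizedBidisc_eq ⟨x, hx, rfl⟩ ⟨y, hy, rfl⟩,
      symmetrizedBidiscKernel_symmetrization]
  · rw [bergmanKernel_symmetrizedBidisc_eq hz hw]
    exact symmetrizedBidiscKernel_ne_zero hz hw
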